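/- Fix integers $k\ge 2$ and $n,d\ge 0$. Put $\mathrm{sgn}(t)=1$ for $t\ge 0$ and $\mathrm{sgn}(t)=-1$ for $t<0$. **Robust Max $k$-AllEqual.** Let $S$ be a finite family of clauses over variables $x_1,\dots,x_n\in\{-1,1\}$. A clause $C$ consists of $k$ literals $l_t=c_t x_{i_t}$ with $c_t\in\{-1,1\}$ and distinct variables $x_{i_1},\dots,x_{i_k}$; it is satisfied if $l_1=\dots=l_k=1$ or $l_1=\dots=l_k=-1$. Let $\mathcal W\subseteq\mathbb R_{\ge 0}^{S}$ be a set of weight vectors and let $$\mathrm{Val(AE)}=\max_{x\in\{-1,1\}^n}\ \inf_{w\in\mathcal W}\ \sum_{C\text{ satisfied by }x} w_C .$$ The relaxation (AE-R) is $$\max_{u_1,\dots,u_n\in\mathbb R^d,\ \|u_i\|=1}\ \frac1{k^2}\,\inf_{w\in\mathcal W}\ \sum_{C\in S}w_C\Big\|\sum_{t=1}^k c_t u_{i_t}\Big\|^2 .$$ **Algorithm.** Step 1: take any optimal solution $\hat u_1,\dots,\hat u_n$ of (AE-R). Step 2: round it to a random $\hat z\in\{-1,1\}^n$ whose law satisfies,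 for every positive semidefinite $A\in\mathbb R^{n\times n}$, $$\mathbb E\Big[\sum_{i,j}A_{ij}\hat z_i\hat z_j\Big]\ \ge\ \frac2\pi\sum_{i,j}A_{ij}\,\hat u_i\cdot\hat u_j. \tag{1}$$ Step 3: given $\hat z$, independently set $\hat x_i=1$ with probability $\frac12\big(1+\sqrt{2/k}\,\hat z_i\big)$ and $\hat x_i=-1$ otherwise. **Theorem.** 1. Random hyperplane rounding is a valid Step 2: for all unit vectors $\hat u_1,\dots,\hat u_n\in\mathbb R^d$ and a standard Gaussian vector $g$ in $\mathbb R^d$, the vector $\hat z_i=\mathrm{sgn}(\hat u_i\cdot g)$ satisfies (1) for every positive semidefinite $A$. 2. For every instance of robust Max $k$-AllEqual, every optimal $\hat u$ and every rounding satisfying (1), the output $\hat x$ satisfies $$\mathbb E\Big[\sum_{C\text{ satisfied by }\hat x}w_C\Big]\ \ge\ \frac{0.88\,k}{2^k}\,\mathrm{Val(AE)}\qquad\text{for all } w\in\mathcal W .$$ 3. Consider robust Max $k$-CSP: a finite family of constraints, each given by $k$ distinct variables and an arbitrary set of allowed value tuples in $\{-1,1\}^k$, a set $\mathcal W$ of nonnegative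 weight vectors on the constraints, and $\mathrm{Val(CSP)}=\max_x\inf_{w\in\mathcal W}\sum_{C\text{ satisfied by }x}w_C$. Replace each constraint $C$ on $x_{i_1},\dots,x_{i_k}$ by the clauses $a_1x_{i_1}\equiv\dots\equiv a_kx_{i_k}$, one for each allowed tuple $a$ of $C$, each with weight $w_C$. Run the algorithm above on this robust Max $k$-AllEqual instance and output $\hat x$ or $-\hat x$ with probability $\frac12$ each. Then the expected weight of the satisfied constraints is at least $\frac{0.44\,k}{2^k}\,\mathrm{Val(CSP)}$ for all $w\in\mathcal W$. -/

import Mathlib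

open MeasureTheory ProbabilityTheory
open scoped BigOperators ENNReal

noncomputable section

namespace RobustCSP

/-- A truth assignment `x : {1, …, n} → {-1, 1}`; the two truth values are the units `1, -1` of `ℤ`. -/
abbrev Assignment (n : ℕ) := Fin n → ℤˣ

/-- The real number `1` or `-1` given by a sign. -/
def signR (s : ℤˣ) : ℝ := ((s : ℤ) : ℝ)

/-! ### Robust Max k-AllEqual -/

/-- A clause `l₁ ≡ l₂ ≡ ⋯ ≡ l_k` on `k` distinct variables. The literal `l_t` is the variable
`var t` if `sgn t = 1`, and its negation if `sgn t = -1`. -/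
structure Clause (n k : ℕ) where
  var : Fin k ↪ Fin n
  sgn : Fin k → ℤˣ

/-- The value of the `t`-th literal of a clause under an assignment. -/
def Clause.literal {n k : ℕ} (C : Clause n k) (x : Assignment n) (t : Fin k) : ℤˣ :=
  C.sgn t * x (C.var t)

/-- `l₁ = ⋯ = l_k = 1` or `l₁ = ⋯ = l_k = -1`. -/
def Clause.Sat {n k : ℕ} (C : Clause n k) (x : Assignment n) : Prop :=
  (∀ t, C.literal x t = 1) ∨ (∀ t, C.literal x t = -1)

open Classical in
/-- The total weight, for the weight vector `w`, of the clauses that `x` satisfies. -/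
def aeValue {n k : ℕ} {ι : Type*} [Fintype ι] (S : ι → Clause n k) (w : ι → ℝ)
    (x : Assignment n) : ℝ :=
  ∑ j, if (S j).Sat x then w j else 0

/-- `Val(AE) = max_x min_{w ∈ W}` of the weight of the satisfied clauses. -/
def aeOpt {n k : ℕ} {ι : Type*} [Fintype ι] (S : ι → Clause n k) (W : Set (ι → ℝ)) : ℝ :=
  ⨆ x : Assignment n, ⨅ w : W, aeValue S w.1 x

/-- `∑_{i ∈ C} u_i`, the sum over the literals of the clause, where `u_{-i} = -u_i`. -/
def Clause.vecSum {n k : ℕ} (C : Clause n k) {d : ℕ} (u : Fin n → EuclideanSpace ℝ (Fin d)) :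
    EuclideanSpace ℝ (Fin d) :=
  ∑ t, signR (C.sgn t) • u (C.var t)

/-- The inner minimum of the relaxation:
`(1 / k²) min_{w ∈ W} ∑_C w_C ‖∑_{i ∈ C} u_i‖²`. -/
def relaxObjective {n k : ℕ} {ι : Type*} [Fintype ι] (S : ι → Clause n k) (W : Set (ι → ℝ))
    {d : ℕ} (u : Fin n → EuclideanSpace ℝ (Fin d)) : ℝ :=
  1 / (k : ℝ) ^ 2 * ⨅ w : W, ∑ j, w.1 j * ‖(S j).vecSum u‖ ^ 2

/-- `u` is an optimal solution of the relaxation (AE-R): unit vectors that maximize the worst-case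
objective among all systems of unit vectors. -/
def IsOptimalRelax {n k : ℕ} {ι : Type*} [Fintype ι] (S : ι → Clause n k) (W : Set (ι → ℝ))
    {d : ℕ} (u : Fin n → EuclideanSpace ℝ (Fin d)) : Prop :=
  (∀ i, ‖u i‖ = 1) ∧
    ∀ v : Fin n → EuclideanSpace ℝ (Fin d), (∀ i, ‖v i‖ = 1) →
      relaxObjective S W v ≤ relaxObjective S W u

/-! ### The rounding steps -/

/-- The expectation of `f` under a law on a finite type. -/
def expect {α : Type*} [Fintype α] (p : PMF α) (f : α → ℝ) : ℝ :=
  ∑ a, (p a).toReal * f a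

/-- A law of a random sign vector `z`, obtained by rounding the unit vectors `u`, that keeps in
expectation a `2 / π` fraction of every positive semidefinite quadratic form:
`E[∑_{ij} A_{ij} z_i z_j] ≥ (2 / π) ∑_{ij} A_{ij} u_i · u_j` for every psd matrix `A`. -/
def IsRounding {n d : ℕ} (u : Fin n → EuclideanSpace ℝ (Fin d)) (ρ : PMF (Assignment n)) : Prop :=
  ∀ A : Matrix (Fin n) (Fin n) ℝ, A.PosSemidef →
    2 / Real.pi * ∑ i, ∑ j, A i j * inner ℝ (u i) (u j) ≤
      expect ρ fun z => ∑ i, ∑ j, A i j * (signR (z i) * signR (z j))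

/-- Random hyperplane rounding of the vectors `u` with normal vector `g`. -/
def hyperplaneRound {n d : ℕ} (u : Fin n → EuclideanSpace ℝ (Fin d))
    (g : EuclideanSpace ℝ (Fin d)) : Assignment n :=
  fun i => if 0 ≤ inner ℝ (u i) g then 1 else -1

theorem measurableSet_hyperplaneRound {n d : ℕ} (u : Fin n → EuclideanSpace ℝ (Fin d))
    (z : Assignment n) : MeasurableSet (hyperplaneRound u ⁻¹' {z}) := by
  have h : hyperplaneRound u ⁻¹' {z} =
      ⋂ i, {g | (if 0 ≤ inner ℝ (u i) g then (1 : ℤˣ) else -1) = z i} := by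
    ext g
    simp [hyperplaneRound, funext_iff]
  rw [h]
  refine MeasurableSet.iInter fun i => ?_
  have hm : MeasurableSet {g : EuclideanSpace ℝ (Fin d) | 0 ≤ inner ℝ (u i) g} :=
    measurableSet_le measurable_const (by fun_prop)
  by_cases h1 : z i = 1
  · convert hm using 1
    ext g
    by_cases hg : 0 ≤ inner ℝ (u i) g <;> simp [hg, h1]
  · have h2 : z i = -1 := (Int.units_eq_one_or (z i)).resolve_left h1
    convert hm.compl using 1
    ext g
    by_cases hg : 0 ≤ inner ℝ (u i) g
    · simp [hg, h2]
    · simp [hg, h2, lt_of_not_ge hg]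

/-- The law of `hyperplaneRound u g` for a standard Gaussian vector `g`. -/
def hyperplaneLaw {n d : ℕ} (u : Fin n → EuclideanSpace ℝ (Fin d)) : PMF (Assignment n) :=
  PMF.ofFintype (fun z => stdGaussian (EuclideanSpace ℝ (Fin d)) (hyperplaneRound u ⁻¹' {z})) (by
    rw [sum_measure_preimage_singleton Finset.univ
      (fun z _ => measurableSet_hyperplaneRound u z)]
    simp)

/-- The probability that `x_i = s` given `z_i = ζ`: `(1 + √(2/k) ζ) / 2` for `s = 1` and
`(1 - √(2/k) ζ) / 2` for `s = -1`. -/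
def bitProb (k : ℕ) (ζ s : ℤˣ) : ℝ :=
  (1 + Real.sqrt (2 / k) * signR ζ * signR s) / 2

theorem bitProb_nonneg {k : ℕ} (hk : 2 ≤ k) (ζ s : ℤˣ) : 0 ≤ bitProb k ζ s := by
  have hk' : (2 : ℝ) ≤ k := by exact_mod_cast hk
  have h1 : Real.sqrt (2 / k) ≤ 1 := by
    exact Real.sqrt_le_one.2 ((div_le_one (by linarith)).2 hk')
  have h0 := Real.sqrt_nonneg (2 / (k : ℝ))
  rcases Int.units_eq_one_or ζ with h | h <;> rcases Int.units_eq_one_or s with h' | h' <;>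
    simp only [bitProb, signR, h, h', Units.val_one, Units.val_neg, Int.cast_one, Int.cast_neg] <;>
    linarith

theorem sum_bitProb (k : ℕ) (ζ : ℤˣ) : ∑ s, bitProb k ζ s = 1 := by
  have h : (Finset.univ : Finset ℤˣ) = {1, -1} := rfl
  rw [h, Finset.sum_pair (by decide)]
  simp [bitProb, signR]
  ring

/-- The law of `x` given `z`: the `x_i` are independent, `x_i = 1` with probability
`(1 + √(2/k) z_i) / 2` and `x_i = -1` otherwise. -/
def assignLaw {n k : ℕ} (hk : 2 ≤ k) (z : Assignment n) : PMF (Assignment n) :=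
  PMF.ofFintype (fun x => ENNReal.ofReal (∏ i, bitProb k (z i) (x i))) (by
    rw [← ENNReal.ofReal_sum_of_nonneg
      (fun x _ => Finset.prod_nonneg fun i _ => bitProb_nonneg hk (z i) (x i))]
    have h := Finset.prod_univ_sum (fun _ : Fin n => (Finset.univ : Finset ℤˣ))
      (fun i s => bitProb k (z i) s)
    rw [Fintype.piFinset_univ] at h
    rw [← h]
    simp only [sum_bitProb, Finset.prod_const_one, ENNReal.ofReal_one])

/-- The law of the output `x` of the algorithm for Max k-AllEqual: draw `z` from the law `ρ`, then
draw `x` given `z`. -/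
def aeOutput {n k : ℕ} (hk : 2 ≤ k) (ρ : PMF (Assignment n)) : PMF (Assignment n) :=
  ρ.bind fun z => assignLaw hk z

/-! ### Robust Max k-CSP -/

/-- A constraint on `k` distinct variables: the tuples of values of these variables that satisfy
the constraint form an arbitrary set `allowed`. -/
structure Constraint (n k : ℕ) where
  var : Fin k ↪ Fin n
  allowed : Finset (Fin k → ℤˣ)

/-- `x` satisfies the constraint. -/
def Constraint.Sat {n k : ℕ} (C : Constraint n k) (x : Assignment n) : Prop :=
  (fun t => x (C.var t)) ∈ C.allowed

open Classical in
/-- The total weight, for the weight vector `w`, of the constraints that `x` satisfies. -/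
def cspValue {n k : ℕ} {ι : Type*} [Fintype ι] (S : ι → Constraint n k) (w : ι → ℝ)
    (x : Assignment n) : ℝ :=
  ∑ j, if (S j).Sat x then w j else 0

/-- The optimal value of robust Max k-CSP. -/
def cspOpt {n k : ℕ} {ι : Type*} [Fintype ι] (S : ι → Constraint n k) (W : Set (ι → ℝ)) : ℝ :=
  ⨆ x : Assignment n, ⨅ w : W, cspValue S w.1 x

/-- The index set of the clauses of the reduced instance: one clause for each constraint and each
tuple of values that satisfies it. -/
abbrev ReducedIndex {n k : ℕ} {ι : Type*} (S : ι → Constraint n k) :=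
  Σ j, {a : Fin k → ℤˣ // a ∈ (S j).allowed}

/-- The reduction from Max k-CSP to Max k-AllEqual. The constraint `C` is the disjunction, over its
satisfying tuples `a`, of the conjunctions `l₁ ∧ ⋯ ∧ l_k` of the literals that are true exactly
at `a`; each such conjunction is replaced by the clause `l₁ ≡ ⋯ ≡ l_k`. -/
def reduceClauses {n k : ℕ} {ι : Type*} (S : ι → Constraint n k) :
    ReducedIndex S → Clause n k :=
  fun p => ⟨(S p.1).var, p.2.1⟩

/-- The weight vectors of the reduced instance: each clause has the weight of its constraint. -/
def reduceWeights {n k : ℕ} {ι : Type*} (S : ι → Constraint n k) (W : Set (ι → ℝ)) :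
    Set (ReducedIndex S → ℝ) :=
  (fun w p => w p.1) '' W

/-- The law of the output of the algorithm for Max k-CSP: the output `x` of the algorithm for
Max k-AllEqual, or its negation `-x`, with probability `1/2` each. -/
def cspOutput {n k : ℕ} (hk : 2 ≤ k) (ρ : PMF (Assignment n)) : PMF (Assignment n) :=
  (aeOutput hk ρ).bind fun x => (PMF.uniformOfFintype ℤˣ).map fun s => fun i => s * x i

end RobustCSP

end

namespace RobustCSP

/-! Rounding loses a factor at two places: passing from vectors to signs `z`, and from `z` to
independent biased bits.

Hyperplane rounding: put c = √(2/π). For unit `u i` and a standard Gaussian `g`, both E[⟪u i, g⟫⟪u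
j, g⟫] = ⟪u i, u j⟫ and E[z_i ⟪u j, g⟫] = c ⟪u i, u j⟫. A psd form is nonnegative at the vector z_i
- c⟪u i, g⟫, and taking expectations gives E[zᵀAz] ≥ (2c² - c²) ∑ A_ij ⟪u i, u j⟫, where c² = 2/π
(`integral_innerSign_quadratic`).

Biased bits: if `z` makes p literals of a clause true and q false, then with α = √(2/k) the clause
is satisfied with probability ((1+α)^p (1-α)^q + (1-α)^p (1+α)^q) / 2^k. The analytic core,
`pow_mul_pow_add_ge`, bounds the numerator below by 0.44 π (p-q)²/k. Since p - q is the sum of the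
literals, (p-q)² is a rank-one psd form in `z`, so the rounding hypothesis gives E[(p-q)²] ≥
(2/π)‖vecSum‖². The factors π cancel and leave 0.88. Everything is linear in the weights, so one
random output serves every `w` in `W`; the relaxation dominates the optimum by taking all vectors to
be ± one unit vector.

For k-CSP, an AllEqual clause is satisfied by `x` exactly when its tuple is matched by `x` or by
`-x`. A uniformly random global sign therefore costs only the factor 1/2. -/

lemma abs_signR (s : ℤˣ) : |signR s| = 1 := by
  rcases Int.units_eq_one_or s with h | h <;> simp [signR, h]

lemma signR_mul (s t : ℤˣ) : signR (s * t) = signR s * signR t := by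
  simp [signR]

lemma signR_neg (s : ℤˣ) : signR (-s) = -signR s := by
  simp [signR]

/-! ### Gaussian moments and random hyperplane rounding -/

lemma integral_abs_gaussianReal : ∫ x, |x| ∂(gaussianReal 0 1) = √(2 / Real.pi) := by
  rw [integral_gaussianReal_eq_integral_smul one_ne_zero]
  -- As a function of |x| with real exponents, the integrand folds onto the half-line and becomes a
  -- Gamma integral, here with value Γ(1).
  have h1 : ∀ x : ℝ, gaussianPDFReal 0 1 x • |x| =
      (fun y => (√(2 * Real.pi))⁻¹ * (y ^ (1 : ℝ) * Real.exp (-(1 / 2) * y ^ (2 : ℝ)))) |x| := by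
    intro x
    simp only [gaussianPDFReal, smul_eq_mul, Real.rpow_one, Real.rpow_two, sq_abs, sub_zero,
      NNReal.coe_one, mul_one]
    ring_nf
  rw [integral_congr_ae (.of_forall h1), integral_comp_abs (f := fun y =>
      (√(2 * Real.pi))⁻¹ * (y ^ (1 : ℝ) * Real.exp (-(1 / 2) * y ^ (2 : ℝ)))), integral_const_mul,
    integral_rpow_mul_exp_neg_mul_rpow (by norm_num) (by norm_num) (by norm_num)]
  have h2 : (-((1 : ℝ) + 1) / 2) = -1 := by norm_num
  have h3 : (((1 : ℝ) + 1) / 2) = 1 := by norm_num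
  rw [h2, h3, Real.Gamma_one, Real.rpow_neg_one]
  have hp := Real.pi_pos
  rw [Real.sqrt_div (by norm_num), Real.sqrt_mul (by norm_num)]
  have h4 : √2 * √2 = 2 := Real.mul_self_sqrt (by norm_num)
  field_simp
  nlinarith

section Gaussian

variable {E : Type*} [NormedAddCommGroup E] [InnerProductSpace ℝ E] [FiniteDimensional ℝ E]
  [MeasurableSpace E] [BorelSpace E]

lemma memLp_inner_stdGaussian (v : E) : MemLp (fun g => inner ℝ v g) 2 (stdGaussian E) :=
  IsGaussian.memLp_dual (stdGaussian E) (innerSL ℝ v) 2 (by simp)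

lemma integrable_inner_stdGaussian (v : E) : Integrable (fun g => inner ℝ v g) (stdGaussian E) :=
  (memLp_inner_stdGaussian v).integrable (by norm_num)

lemma integral_inner_mul_inner_stdGaussian (u v : E) :
    ∫ g, inner ℝ u g * inner ℝ v g ∂(stdGaussian E) = inner ℝ u v := by
  have h := covarianceBilin_apply (μ := stdGaussian E) IsGaussian.memLp_two_id u v
  have h0 : ∫ x, id x ∂(stdGaussian E) = 0 := integral_id_stdGaussian
  rw [covarianceBilin_stdGaussian, h0] at h
  simp only [sub_zero] at h
  rw [← h]
  rfl

lemma integral_abs_inner_stdGaussian {u : E} (hu : ‖u‖ = 1) :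
    ∫ g, |inner ℝ u g| ∂(stdGaussian E) = √(2 / Real.pi) := by
  have h := IsGaussian.map_eq_gaussianReal (μ := stdGaussian E) (innerSL ℝ u)
  rw [variance_dual_stdGaussian, integral_strongDual_stdGaussian, innerSL_apply_norm, hu] at h
  rw [← integral_abs_gaussianReal]
  have h' : gaussianReal 0 1 = (stdGaussian E).map (innerSL ℝ u) := by rw [h]; simp
  rw [h', integral_map (by fun_prop) (by fun_prop)]
  rfl

/-- The sign of `⟪u, g⟫`, with value `1` at `0`. -/
noncomputable def innerSign (u g : E) : ℤˣ := if 0 ≤ inner ℝ u g then 1 else -1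

omit [FiniteDimensional ℝ E] [MeasurableSpace E] [BorelSpace E] in
lemma signR_innerSign_mul (u g : E) : signR (innerSign u g) * inner ℝ u g = |inner ℝ u g| := by
  unfold innerSign
  split_ifs with h
  · simp [signR, abs_of_nonneg h]
  · simp [signR, abs_of_neg (not_le.1 h)]

lemma measurable_signR_innerSign (u : E) : Measurable fun g => signR (innerSign u g) := by
  have : (fun g => signR (innerSign u g)) = fun g => if 0 ≤ inner ℝ u g then (1 : ℝ) else -1 := by
    ext g
    unfold innerSign
    split_ifs <;> simp [signR]
  rw [this]
  exact Measurable.ite (measurableSet_le measurable_const (by fun_prop)) measurable_const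
    measurable_const

lemma integrable_innerSign_mul {f : E → ℝ} (hf : Integrable f (stdGaussian E)) (u : E) :
    Integrable (fun g => signR (innerSign u g) * f g) (stdGaussian E) :=
  hf.bdd_mul (c := 1) (measurable_signR_innerSign u).aestronglyMeasurable
    (.of_forall fun g => by simp [abs_signR])

/-- The reflection in the line spanned by `u` preserves the Gaussian measure and ⟪u, g⟫ but negates
⟪w, g⟫, so the integral equals its own negative. -/
lemma integral_innerSign_mul_inner_of_orthogonal {u w : E} (h : inner ℝ u w = 0) :
    ∫ g, signR (innerSign u g) * inner ℝ w g ∂(stdGaussian E) = 0 := by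
  let R := (Submodule.span ℝ {u}).reflection
  have hu : R u = u :=
    Submodule.reflection_mem_subspace_eq_self (Submodule.mem_span_singleton_self u)
  have hw : R w = -w := Submodule.reflection_mem_subspace_orthogonalComplement_eq_neg
    (Submodule.mem_orthogonal_singleton_iff_inner_right.2 h)
  have h1 : ∀ g, inner ℝ u (R g) = inner ℝ u g := fun g => by
    conv_lhs => rw [← hu]
    exact R.inner_map_map u g
  have h2 : ∀ g, inner ℝ w (R g) = -inner ℝ w g := fun g => by
    rw [← inner_neg_left, ← R.inner_map_map (-w) g, map_neg, hw, neg_neg]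
  have h3 : ∫ g, signR (innerSign u g) * inner ℝ w g ∂(stdGaussian E) =
      ∫ g, signR (innerSign u (R g)) * inner ℝ w (R g) ∂(stdGaussian E) := by
    conv_lhs => rw [← stdGaussian_map R]
    rw [integral_map (by fun_prop)]
    exact ((measurable_signR_innerSign u).mul (by fun_prop)).aestronglyMeasurable
  have h4 : ∀ g, innerSign u (R g) = innerSign u g := fun g => by simp [innerSign, h1]
  simp_rw [h4, h2, mul_neg, integral_neg] at h3
  linarith

/-- Split `v` into its component along `u`, which contributes the mean of |⟪u, g⟫|, and an
orthogonal part, which contributes nothing. -/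
lemma integral_innerSign_mul_inner {u : E} (hu : ‖u‖ = 1) (v : E) :
    ∫ g, signR (innerSign u g) * inner ℝ v g ∂(stdGaussian E) =
      √(2 / Real.pi) * inner ℝ u v := by
  set r : ℝ := inner ℝ u v
  have h : inner ℝ u (v - r • u) = 0 := by
    rw [inner_sub_right, inner_smul_right, real_inner_self_eq_norm_sq, hu]
    simp [r]
  have h1 : ∀ g, signR (innerSign u g) * inner ℝ v g =
      r * |inner ℝ u g| + signR (innerSign u g) * inner ℝ (v - r • u) g := fun g => by
    rw [← signR_innerSign_mul, inner_sub_left, real_inner_smul_left]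
    ring
  simp_rw [h1]
  rw [integral_add ((integrable_inner_stdGaussian u).abs.const_mul r)
    (integrable_innerSign_mul (integrable_inner_stdGaussian _) u), integral_const_mul,
    integral_abs_inner_stdGaussian hu, integral_innerSign_mul_inner_of_orthogonal h]
  ring

lemma sum_mul_mul_nonneg_of_posSemidef {n : ℕ} {A : Matrix (Fin n) (Fin n) ℝ}
    (hA : A.PosSemidef) (x : Fin n → ℝ) : 0 ≤ ∑ i, ∑ j, A i j * (x i * x j) := by
  have h := hA.dotProduct_mulVec_nonneg x
  simp only [dotProduct, Matrix.mulVec, Finset.mul_sum, Pi.star_apply, star_trivial] at h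
  refine h.trans_eq (Finset.sum_congr rfl fun i _ => Finset.sum_congr rfl fun j _ => by ring)

/-- Random hyperplane rounding keeps a `2 / π` fraction of every psd quadratic form. -/
lemma integral_innerSign_quadratic {n : ℕ} (u : Fin n → E) (hu : ∀ i, ‖u i‖ = 1)
    {A : Matrix (Fin n) (Fin n) ℝ} (hA : A.PosSemidef) :
    2 / Real.pi * ∑ i, ∑ j, A i j * inner ℝ (u i) (u j) ≤
      ∫ g, ∑ i, ∑ j, A i j * (signR (innerSign (u i) g) * signR (innerSign (u j) g))
        ∂(stdGaussian E) := by
  set c := √(2 / Real.pi)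
  have hc : c * c = 2 / Real.pi := Real.mul_self_sqrt (by positivity)
  let F (i j : Fin n) (g : E) : ℝ := signR (innerSign (u i) g) * signR (innerSign (u j) g)
  let G (i j : Fin n) (g : E) : ℝ := signR (innerSign (u i) g) * inner ℝ (u j) g
  let H (i j : Fin n) (g : E) : ℝ := inner ℝ (u i) g * inner ℝ (u j) g
  have hF : ∀ i j, Integrable (F i j) (stdGaussian E) := fun i j =>
    integrable_innerSign_mul (Integrable.of_bound (C := 1)
      (measurable_signR_innerSign (u j)).aestronglyMeasurable
      (.of_forall fun g => by simp [abs_signR])) (u i)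
  have hG : ∀ i j, Integrable (G i j) (stdGaussian E) := fun i j =>
    integrable_innerSign_mul (integrable_inner_stdGaussian _) (u i)
  have hH : ∀ i j, Integrable (H i j) (stdGaussian E) := fun i j =>
    (memLp_inner_stdGaussian (u i)).integrable_mul (memLp_inner_stdGaussian (u j))
  -- The (i, j) product of entries of the vector z_i - c⟪u i, g⟫, expanded. The cross terms
  -- integrate to -2c²⟪u i, u j⟫ and the last term returns c²⟪u i, u j⟫.
  let Q (i j : Fin n) (g : E) : ℝ := F i j g - c * G i j g - c * G j i g + c * c * H i j g
  have hQ₁ : ∀ i j, Integrable (fun g => F i j g - c * G i j g) (stdGaussian E) :=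
    fun i j => (hF i j).sub ((hG i j).const_mul c)
  have hQ₂ : ∀ i j, Integrable (fun g => F i j g - c * G i j g - c * G j i g) (stdGaussian E) :=
    fun i j => (hQ₁ i j).sub ((hG j i).const_mul c)
  have hQ : ∀ i j, Integrable (Q i j) (stdGaussian E) :=
    fun i j => (hQ₂ i j).add ((hH i j).const_mul (c * c))
  have hval : ∀ i j, ∫ g, Q i j g ∂(stdGaussian E) =
      ∫ g, F i j g ∂(stdGaussian E) - 2 / Real.pi * inner ℝ (u i) (u j) := by
    intro i j
    simp only [Q]
    rw [integral_add (hQ₂ i j) ((hH i j).const_mul (c * c)),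
      integral_sub (hQ₁ i j) ((hG j i).const_mul c),
      integral_sub (hF i j) ((hG i j).const_mul c)]
    simp only [integral_const_mul]
    rw [integral_innerSign_mul_inner (hu i), integral_innerSign_mul_inner (hu j),
      integral_inner_mul_inner_stdGaussian, real_inner_comm (u i) (u j),
      show √(2 / Real.pi) = c from rfl, ← hc]
    ring
  have hsum : ∀ K : Fin n → Fin n → E → ℝ, (∀ i j, Integrable (K i j) (stdGaussian E)) →
      ∫ g, ∑ i, ∑ j, A i j * K i j g ∂(stdGaussian E) =
        ∑ i, ∑ j, A i j * ∫ g, K i j g ∂(stdGaussian E) := fun K hK => by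
    rw [integral_finsetSum (f := fun i g => ∑ j, A i j * K i j g) _
      fun i _ => integrable_finsetSum _ fun j _ => (hK i j).const_mul (A i j)]
    refine Finset.sum_congr rfl fun i _ => ?_
    rw [integral_finsetSum (f := fun j g => A i j * K i j g) _
      fun j _ => (hK i j).const_mul (A i j)]
    simp only [integral_const_mul]
  have key : 0 ≤ ∫ g, ∑ i, ∑ j, A i j * Q i j g ∂(stdGaussian E) := by
    refine integral_nonneg fun g => ?_
    refine (sum_mul_mul_nonneg_of_posSemidef hA
      fun i => signR (innerSign (u i) g) - c * inner ℝ (u i) g).trans_eq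
      (Finset.sum_congr rfl fun i _ => Finset.sum_congr rfl fun j _ => ?_)
    simp only [Q, F, G, H]
    ring
  rw [hsum Q hQ] at key
  simp_rw [hval, mul_sub, Finset.sum_sub_distrib] at key
  change _ ≤ ∫ g, ∑ i, ∑ j, A i j * F i j g ∂(stdGaussian E)
  simp_rw [hsum F hF, Finset.mul_sum]
  refine le_trans (le_of_eq ?_) (sub_nonneg.1 key)
  exact Finset.sum_congr rfl fun i _ => Finset.sum_congr rfl fun j _ => by ring

end Gaussian

lemma expect_hyperplaneLaw {n d : ℕ} (u : Fin n → EuclideanSpace ℝ (Fin d))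
    (f : Assignment n → ℝ) :
    expect (hyperplaneLaw u) f =
      ∫ g, f (hyperplaneRound u g) ∂(stdGaussian (EuclideanSpace ℝ (Fin d))) := by
  have h1 : ∀ g, f (hyperplaneRound u g) =
      ∑ z, (hyperplaneRound u ⁻¹' {z}).indicator (fun _ => f z) g := fun g => by
    classical
    simp [Set.indicator_apply, Finset.sum_ite_eq]
  simp_rw [h1]
  rw [integral_finsetSum _ fun z _ =>
    (integrable_const _).indicator (measurableSet_hyperplaneRound u z)]
  refine Finset.sum_congr rfl fun z _ => ?_
  rw [integral_indicator_const _ (measurableSet_hyperplaneRound u z)]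
  rfl

theorem isRounding_hyperplaneLaw {n d : ℕ} (u : Fin n → EuclideanSpace ℝ (Fin d))
    (hu : ∀ i, ‖u i‖ = 1) : IsRounding u (hyperplaneLaw u) := fun A hA => by
  rw [expect_hyperplaneLaw]
  exact integral_innerSign_quadratic u hu hA

/-! ### The numerical inequality for the biased bits -/

/-- The minimum of cosh t / t² lies near t² = 4.2655, and 0.93938 is slightly below it. The Taylor
polynomial in v = t² through v⁵ is replaced by its tangent line at 4.2655, leaving a linear
inequality. -/
lemma cosh_lower_bound (t : ℝ) : 0.93938 * t ^ 2 ≤ Real.cosh t := by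
  have h := sum_le_hasSum (Finset.range 6) (fun i _ => by rw [pow_mul]; positivity)
    (Real.hasSum_cosh t)
  simp only [Finset.sum_range_succ, Finset.sum_range_zero, Nat.factorial, pow_mul] at h
  norm_num at h
  have hv : 0 ≤ t ^ 2 := sq_nonneg t
  generalize t ^ 2 = v at *
  have h2 : 4.2655 ^ 2 + 2 * 4.2655 * (v - 4.2655) ≤ v ^ 2 := by nlinarith [sq_nonneg (v - 4.2655)]
  have h3 : 4.2655 ^ 3 + 3 * 4.2655 ^ 2 * (v - 4.2655) ≤ v ^ 3 := by
    have : 0 ≤ (v - 4.2655) ^ 2 * (v + 2 * 4.2655) := by positivity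
    linarith
  have h4 : 4.2655 ^ 4 + 4 * 4.2655 ^ 3 * (v - 4.2655) ≤ v ^ 4 := by
    have : 0 ≤ (v - 4.2655) ^ 2 * (v ^ 2 + 2 * 4.2655 * v + 3 * 4.2655 ^ 2) := by positivity
    linarith
  have h5 : 4.2655 ^ 5 + 5 * 4.2655 ^ 4 * (v - 4.2655) ≤ v ^ 5 := by
    have : 0 ≤ (v - 4.2655) ^ 2 *
      (v ^ 3 + 2 * 4.2655 * v ^ 2 + 3 * 4.2655 ^ 2 * v + 4 * 4.2655 ^ 3) := by positivity
    linarith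
  linarith

lemma log_one_sub_lower_bound {a : ℝ} (h0 : 0 < a) (h1 : a ≤ 2 / 5) :
    -a - 2 * a * ((a / 3 + a ^ 2 / 5) - (a / 3 + a ^ 2 / 5) ^ 2 / 2) ≤ Real.log (1 - a) := by
  have h := Real.abs_log_sub_add_sum_range_le (x := a) (by rw [abs_of_pos h0]; linarith) 5
  rw [abs_of_pos h0] at h
  have h2 := (abs_le.1 h).1
  simp only [Finset.sum_range_succ, Finset.sum_range_zero] at h2
  have h3 : a ^ 6 / (1 - a) ≤ a ^ 6 * (5 / 3) := by
    rw [div_le_iff₀ (by linarith)]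
    nlinarith [pow_pos h0 6]
  have e2 : a ^ 2 ≤ 4 / 25 := by nlinarith
  -- This is exactly the gap between the degree-5 Taylor bound, with remainder at most (5/3)a⁶, and
  -- the claimed lower bound.
  have : 0 ≤ a ^ 2 * (1 / 6 - 2 / 45 * a - 23 / 60 * a ^ 2 - 6 / 25 * (a ^ 2 * a)
      - 5 / 3 * (a ^ 2 * a ^ 2)) := by
    refine mul_nonneg (sq_nonneg a) ?_
    have e3 : a ^ 2 * a ≤ 4 / 25 * (2 / 5) := by gcongr
    have e4 : a ^ 2 * a ^ 2 ≤ 4 / 25 * (4 / 25) := by gcongr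
    linarith
  norm_num at h2
  nlinarith

/-- With a = α² = 2/k, the factor (1-a)^(1/a) is below its limit 1/e. The excess of artanh α over α
makes up for this: 1 + a/3 + a²/5 is the truncated series of artanh α / α. To first order in the
exponent, the gain 2a/3 beats the loss a/2. -/
lemma exp_neg_one_le_of_le {a : ℝ} (h0 : 0 < a) (h1 : a ≤ 2 / 5) :
    Real.exp (-1) ≤ Real.exp (Real.log (1 - a) / a) * (1 + (a / 3 + a ^ 2 / 5)) ^ 2 := by
  have hl := log_one_sub_lower_bound h0 h1
  set y := a / 3 + a ^ 2 / 5 with hy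
  have hy0 : 0 < y := by positivity
  have h2 : y - y ^ 2 / 2 ≤ Real.log (1 + y) := by
    refine le_trans ?_ (Real.le_log_one_add_of_nonneg hy0.le)
    rw [le_div_iff₀ (by linarith)]
    nlinarith [pow_pos hy0 3]
  have h3 : -1 - 2 * (y - y ^ 2 / 2) ≤ Real.log (1 - a) / a := by
    rw [le_div_iff₀ h0]
    linarith
  rw [← Real.exp_log (show 0 < 1 + y by linarith), ← Real.exp_nat_mul, ← Real.exp_add]
  refine Real.exp_le_exp.2 ?_
  push_cast
  linarith

lemma log_sub_log_lower_bound {x : ℝ} (h0 : 0 ≤ x) (h1 : x < 1) :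
    2 * x * (1 + (x ^ 2 / 3 + (x ^ 2) ^ 2 / 5)) ≤ Real.log (1 + x) - Real.log (1 - x) := by
  have h := sum_le_hasSum (Finset.range 3) (fun i _ => by positivity)
    (Real.hasSum_log_sub_log_of_abs_lt_one (x := x) (by rwa [abs_of_nonneg h0]))
  simp only [Finset.sum_range_succ, Finset.sum_range_zero] at h
  norm_num at h
  refine le_trans (le_of_eq ?_) h
  ring

/-- Here the constant 0.44 is fixed; the two sides agree to about five digits. -/
lemma pi_mul_le_exp_neg_one_mul : 0.44 * Real.pi ≤ 0.93938 * 4 * Real.exp (-1) := by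
  have h1 := Real.exp_one_lt_d9
  have h2 := Real.pi_lt_d6
  have h3 : 1 / 2.7182818286 ≤ Real.exp (-1) := by
    rw [Real.exp_neg, ← one_div]
    exact one_div_le_one_div_of_le (Real.exp_pos 1) h1.le
  have h4 : (0.44 : ℝ) * 3.141593 ≤ 0.93938 * 4 * (1 / 2.7182818286) := by norm_num
  linarith

/-- The product form as a hyperbolic cosine. -/
lemma pow_mul_pow_add_eq_cosh {α : ℝ} (h0 : 0 ≤ α) (h1 : α < 1) (p q : ℕ) :
    (1 + α) ^ p * (1 - α) ^ q + (1 - α) ^ p * (1 + α) ^ q =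
      2 * Real.exp (((p + q : ℕ) : ℝ) / 2 * Real.log (1 - α ^ 2)) *
        Real.cosh (((p : ℝ) - q) * ((Real.log (1 + α) - Real.log (1 - α)) / 2)) := by
  have hp : 0 < 1 + α := by linarith
  have hm : 0 < 1 - α := by linarith
  have hl : Real.log (1 - α ^ 2) = Real.log (1 + α) + Real.log (1 - α) := by
    rw [← Real.log_mul hp.ne' hm.ne']
    congr 1
    ring
  rw [Real.cosh_eq, hl]
  conv_lhs => rw [← Real.exp_log hp, ← Real.exp_log hm]
  simp only [← Real.exp_nat_mul, ← Real.exp_add]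
  rw [mul_div_assoc', mul_assoc, mul_add, ← Real.exp_add, ← Real.exp_add,
    mul_div_cancel_left₀ _ two_ne_zero]
  push_cast
  congr 2 <;> ring

/-- The sum is 2 (1-α²)^(k/2) cosh((p-q)β) with β = artanh α. Bounding cosh by a multiple of its
squared argument leaves (1-a)^(1/a) β², which is at least a/e; finally a = 2/k. -/
lemma pow_mul_pow_add_ge_of_five_le {k p q : ℕ} (hk : 5 ≤ k) (hpq : p + q = k) :
    0.44 * Real.pi * ((p : ℝ) - q) ^ 2 / k ≤
      (1 + √(2 / k)) ^ p * (1 - √(2 / k)) ^ q + (1 - √(2 / k)) ^ p * (1 + √(2 / k)) ^ q := by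
  have hk' : (5 : ℝ) ≤ k := by exact_mod_cast hk
  set α := √(2 / (k : ℝ)) with hα
  set a : ℝ := 2 / k with ha
  have ha0 : 0 < a := by positivity
  have ha1 : a ≤ 2 / 5 := by rw [ha]; gcongr
  have hsq : α ^ 2 = a := Real.sq_sqrt ha0.le
  have hα0 : 0 ≤ α := Real.sqrt_nonneg _
  have hα1 : α < 1 := by nlinarith
  rw [pow_mul_pow_add_eq_cosh hα0 hα1, hpq, hsq]
  have hl := log_sub_log_lower_bound hα0 hα1
  rw [hsq] at hl
  set β := (Real.log (1 + α) - Real.log (1 - α)) / 2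
  set y := a / 3 + a ^ 2 / 5
  have hβ : a * (1 + y) ^ 2 ≤ β ^ 2 := by
    have : α * (1 + y) ≤ β := by simp only [β]; linarith
    calc a * (1 + y) ^ 2 = (α * (1 + y)) ^ 2 := by rw [mul_pow, hsq]
      _ ≤ β ^ 2 := by gcongr
  have he := exp_neg_one_le_of_le ha0 ha1
  have hka : (k : ℝ) / 2 * Real.log (1 - a) = Real.log (1 - a) / a := by
    rw [ha]; field_simp
  rw [hka]
  set e := Real.exp (Real.log (1 - a) / a)
  have he0 : 0 < e := Real.exp_pos _
  set s := (p : ℝ) - q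
  have h1a : 1 / (k : ℝ) = a / 2 := by rw [ha]; field_simp
  calc 0.44 * Real.pi * s ^ 2 / k = 0.44 * Real.pi * (s ^ 2 * (a / 2)) := by rw [← h1a]; ring
    _ ≤ (0.93938 * 4 * Real.exp (-1)) * (s ^ 2 * (a / 2)) := by
      gcongr ?_ * _
      exact pi_mul_le_exp_neg_one_mul
    _ ≤ (0.93938 * 4 * (e * (1 + y) ^ 2)) * (s ^ 2 * (a / 2)) := by gcongr
    _ = 0.93938 * 2 * e * s ^ 2 * (a * (1 + y) ^ 2) := by ring
    _ ≤ 0.93938 * 2 * e * s ^ 2 * β ^ 2 := by gcongr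
    _ = 2 * e * (0.93938 * (s * β) ^ 2) := by ring
    _ ≤ 2 * e * Real.cosh (s * β) := by
      gcongr
      exact cosh_lower_bound _

lemma pow_mul_pow_add_ge_of_lt_five {k p q : ℕ} (hk : 2 ≤ k) (hk5 : k < 5) (hpq : p + q = k)
    {α : ℝ} (hα : α ^ 2 = 2 / k) :
    0.44 * Real.pi * ((p : ℝ) - q) ^ 2 / k ≤
      (1 + α) ^ p * (1 - α) ^ q + (1 - α) ^ p * (1 + α) ^ q := by
  have hπ := Real.pi_lt_d6
  -- The sum is even in α and of degree at most 4 for k ≤ 4, so α² and α⁴ determine it. For k = 2,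
  -- simplification turns α² = 1 into α = ±1.
  have hα4 : α ^ 4 = (2 / k) ^ 2 := by rw [← hα]; ring
  obtain rfl : q = k - p := by omega
  have hp : p ≤ k := by omega
  interval_cases k <;> interval_cases p <;> norm_num at hα hα4 ⊢ <;>
    first
    | linarith
    | rcases hα with rfl | rfl <;> norm_num <;> linarith

lemma pow_mul_pow_add_ge {k p q : ℕ} (hk : 2 ≤ k) (hpq : p + q = k) :
    0.44 * Real.pi * ((p : ℝ) - q) ^ 2 / k ≤
      (1 + √(2 / k)) ^ p * (1 - √(2 / k)) ^ q + (1 - √(2 / k)) ^ p * (1 + √(2 / k)) ^ q := by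
  rcases lt_or_ge k 5 with h | h
  · exact pow_mul_pow_add_ge_of_lt_five hk h hpq (Real.sq_sqrt (by positivity))
  · exact pow_mul_pow_add_ge_of_five_le h hpq

/-! ### Satisfaction probability of one clause -/

open Classical in
/-- The probability that independent signs take prescribed values at distinct places. -/
lemma sum_prod_mul_indicator {n k : ℕ} (b : Fin n → ℤˣ → ℝ) (hb : ∀ i, ∑ s, b i s = 1)
    (v : Fin k ↪ Fin n) (y : Fin k → ℤˣ) :
    ∑ x : Assignment n, (∏ i, b i (x i)) * (if ∀ t, x (v t) = y t then 1 else 0) =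
      ∏ t, b (v t) (y t) := by
  -- The event factors over coordinates. Off the range of `v` the condition is vacuous and the
  -- factor sums to 1; on the range, injectivity leaves a single condition.
  let h (i : Fin n) (s : ℤˣ) : ℝ := if ∀ t, v t = i → s = y t then 1 else 0
  have h1 : ∀ x : Assignment n, (if ∀ t, x (v t) = y t then (1 : ℝ) else 0) = ∏ i, h i (x i) := by
    intro x
    simp only [h]
    rw [Finset.prod_ite_zero, Finset.prod_const_one]
    have hx : (∀ t, x (v t) = y t) ↔ ∀ i ∈ Finset.univ, ∀ t, v t = i → x i = y t :=
      ⟨fun hx i _ t ht => ht ▸ hx t, fun hx t => hx _ (Finset.mem_univ _) t rfl⟩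
    by_cases hx' : ∀ t, x (v t) = y t
    · rw [if_pos hx', if_pos (hx.1 hx')]
    · rw [if_neg hx', if_neg (mt hx.2 hx')]
  simp_rw [h1, ← Finset.prod_mul_distrib]
  have h2 := Finset.prod_univ_sum (fun _ : Fin n => (Finset.univ : Finset ℤˣ))
    (fun i s => b i s * h i s)
  rw [Fintype.piFinset_univ] at h2
  rw [← h2, ← Finset.prod_subset (Finset.subset_univ (Finset.univ.map v)), Finset.prod_map]
  · simp [h, Int.units_eq_one_or]
  · intro i _ hi
    have hi' : ∀ t, v t ≠ i := fun t ht => hi (by simp [← ht])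
    simpa [h, hi'] using hb i

lemma prod_add_mul_literal {n k : ℕ} (C : Clause n k) (z : Assignment n) (a b : ℝ) :
    ∏ t, (a + b * signR (C.literal z t)) =
      (a + b) ^ (Finset.univ.filter fun t => C.literal z t = 1).card *
        (a - b) ^ (Finset.univ.filter fun t => ¬ C.literal z t = 1).card := by
  rw [← Finset.prod_filter_mul_prod_filter_not Finset.univ (fun t => C.literal z t = 1)]
  congr 1
  · refine Finset.prod_eq_pow_card fun t ht => ?_
    rw [(Finset.mem_filter.1 ht).2]
    simp [signR]
  · refine Finset.prod_eq_pow_card fun t ht => ?_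
    rw [(Int.units_eq_one_or _).resolve_left (Finset.mem_filter.1 ht).2]
    simp [signR, sub_eq_add_neg]

lemma sum_signR_literal {n k : ℕ} (C : Clause n k) (z : Assignment n) :
    ∑ t, signR (C.literal z t) =
      (Finset.univ.filter fun t => C.literal z t = 1).card -
        (Finset.univ.filter fun t => ¬ C.literal z t = 1).card := by
  rw [← Finset.sum_filter_add_sum_filter_not Finset.univ (fun t => C.literal z t = 1),
    sub_eq_add_neg]
  congr 1
  · rw [Finset.sum_congr rfl (g := fun _ => (1 : ℝ))]
    · simp
    · intro t ht
      rw [(Finset.mem_filter.1 ht).2]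
      simp [signR]
  · rw [Finset.sum_congr rfl (g := fun _ => (-1 : ℝ))]
    · simp
    · intro t ht
      rw [(Int.units_eq_one_or _).resolve_left (Finset.mem_filter.1 ht).2]
      simp [signR]

lemma assignLaw_toReal {n k : ℕ} (hk : 2 ≤ k) (z x : Assignment n) :
    (assignLaw hk z x).toReal = ∏ i, bitProb k (z i) (x i) :=
  ENNReal.toReal_ofReal (Finset.prod_nonneg fun i _ => bitProb_nonneg hk (z i) (x i))

open Classical in
lemma expect_assignLaw_literal {n k : ℕ} (hk : 2 ≤ k) (C : Clause n k) (z : Assignment n)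
    (s : ℤˣ) :
    expect (assignLaw hk z) (fun x => if ∀ t, C.literal x t = s then 1 else 0) =
      (∏ t, (1 + √(2 / k) * signR s * signR (C.literal z t))) / 2 ^ k := by
  have h1 : ∀ x : Assignment n, (∀ t, C.literal x t = s) ↔ ∀ t, x (C.var t) = C.sgn t * s :=
    fun x => forall_congr' fun t => by
      unfold Clause.literal
      rw [← eq_inv_mul_iff_mul_eq, Int.units_inv_eq_self]
  simp_rw [expect, assignLaw_toReal, h1]
  rw [sum_prod_mul_indicator (fun i => bitProb k (z i)) (fun i => sum_bitProb k (z i)) C.var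
    (fun t => C.sgn t * s)]
  have h2 : (2 : ℝ) ^ k = ∏ _t : Fin k, 2 := by simp
  rw [h2, ← Finset.prod_div_distrib]
  refine Finset.prod_congr rfl fun t _ => ?_
  rw [bitProb, Clause.literal, signR_mul, signR_mul]
  ring

open Classical in
/-- The last step satisfies a clause with probability at least `0.44 π / (k 2 ^ k)` times the
square of the sum of its literals. -/
lemma expect_assignLaw_sat_ge {n k : ℕ} (hk : 2 ≤ k) (C : Clause n k) (z : Assignment n) :
    0.44 * Real.pi / (k * 2 ^ k) * (∑ t, signR (C.literal z t)) ^ 2 ≤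
      expect (assignLaw hk z) (fun x => if C.Sat x then 1 else 0) := by
  have h1 : ∀ x : Assignment n, (if C.Sat x then (1 : ℝ) else 0) =
      (if ∀ t, C.literal x t = 1 then 1 else 0) + (if ∀ t, C.literal x t = -1 then 1 else 0) := by
    intro x
    -- The two ways to satisfy a clause are disjoint because k > 0, so their probabilities add.
    have h : ¬ ((∀ t, C.literal x t = 1) ∧ ∀ t, C.literal x t = -1) := fun h =>
      absurd ((h.1 ⟨0, by omega⟩).symm.trans (h.2 ⟨0, by omega⟩)) (by decide)
    unfold Clause.Sat
    by_cases h₁ : ∀ t, C.literal x t = 1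
    · rw [if_pos (Or.inl h₁), if_pos h₁, if_neg fun h₂ => h ⟨h₁, h₂⟩, add_zero]
    · simp only [h₁, false_or, if_false, zero_add]
  have h2 : expect (assignLaw hk z) (fun x => if C.Sat x then 1 else 0) =
      expect (assignLaw hk z) (fun x => if ∀ t, C.literal x t = 1 then 1 else 0) +
      expect (assignLaw hk z) (fun x => if ∀ t, C.literal x t = -1 then 1 else 0) := by
    simp_rw [expect, ← Finset.sum_add_distrib, ← mul_add, h1]
  rw [h2, expect_assignLaw_literal, expect_assignLaw_literal, prod_add_mul_literal,
    prod_add_mul_literal, sum_signR_literal]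
  have h3 := pow_mul_pow_add_ge hk
    ((Finset.card_filter_add_card_filter_not (s := Finset.univ)
      fun t => C.literal z t = 1).trans (by simp))
  rw [← add_div, le_div_iff₀ (by positivity)]
  simp only [signR_neg, show signR 1 = 1 by simp [signR], mul_one, mul_neg, ← sub_eq_add_neg,
    sub_neg_eq_add]
  refine le_trans (le_of_eq ?_) h3
  field_simp

/-! ### Expectations under finite laws -/

section Expect

variable {α β : Type*} [Fintype α] [Fintype β]

lemma expect_bind (p : PMF α) (q : α → PMF β) (f : β → ℝ) :
    expect (p.bind q) f = expect p fun a => expect (q a) f := by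
  simp_rw [expect, PMF.bind_apply, tsum_fintype]
  have h : ∀ b, (∑ a, p a * q a b).toReal = ∑ a, (p a).toReal * (q a b).toReal := fun b => by
    rw [ENNReal.toReal_sum fun a _ => ENNReal.mul_ne_top (p.apply_ne_top a) ((q a).apply_ne_top b)]
    simp only [ENNReal.toReal_mul]
  simp_rw [h, Finset.sum_mul, Finset.mul_sum]
  rw [Finset.sum_comm]
  exact Finset.sum_congr rfl fun a _ => Finset.sum_congr rfl fun b _ => by ring

lemma expect_pure (a : α) (f : α → ℝ) : expect (PMF.pure a) f = f a := by
  classical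
  rw [expect, Finset.sum_eq_single a]
  · simp
  · intro b _ hb
    simp [hb]
  · simp

lemma expect_map (p : PMF α) (g : α → β) (f : β → ℝ) :
    expect (p.map g) f = expect p fun a => f (g a) := by
  rw [PMF.map, expect_bind]
  simp [expect_pure]

lemma expect_mono (p : PMF α) {f g : α → ℝ} (h : ∀ a, f a ≤ g a) : expect p f ≤ expect p g :=
  Finset.sum_le_sum fun a _ => mul_le_mul_of_nonneg_left (h a) ENNReal.toReal_nonneg

lemma expect_const_mul (p : PMF α) (c : ℝ) (f : α → ℝ) :
    expect p (fun a => c * f a) = c * expect p f := by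
  simp_rw [expect, Finset.mul_sum]
  exact Finset.sum_congr rfl fun a _ => by ring

lemma expect_sum {ι : Type*} [Fintype ι] (p : PMF α) (f : ι → α → ℝ) :
    expect p (fun a => ∑ j, f j a) = ∑ j, expect p (f j) := by
  simp_rw [expect, Finset.mul_sum]
  exact Finset.sum_comm

lemma expect_uniform_sign (f : ℤˣ → ℝ) :
    expect (PMF.uniformOfFintype ℤˣ) f = (f 1 + f (-1)) / 2 := by
  have h : (Finset.univ : Finset ℤˣ) = {1, -1} := rfl
  rw [expect, h, Finset.sum_pair (by decide)]
  simp
  ring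

end Expect

/-! ### The relaxation and the AllEqual guarantee -/

section AllEqual

variable {n k d : ℕ}

lemma Clause.sum_sgn_smul {V : Type*} [AddCommGroup V] [Module ℝ V] (C : Clause n k)
    (f : Fin n → V) :
    ∑ i, (∑ t, if C.var t = i then signR (C.sgn t) else 0) • f i =
      ∑ t, signR (C.sgn t) • f (C.var t) := by
  simp_rw [Finset.sum_smul]
  rw [Finset.sum_comm]
  simp [ite_smul]

/-- A rounding keeps a `2 / π` fraction of the squared norm of the vector of a clause. -/
lemma IsRounding.expect_sq_ge {u : Fin n → EuclideanSpace ℝ (Fin d)} {ρ : PMF (Assignment n)}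
    (hρ : IsRounding u ρ) (C : Clause n k) :
    2 / Real.pi * ‖C.vecSum u‖ ^ 2 ≤ expect ρ fun z => (∑ t, signR (C.literal z t)) ^ 2 := by
  -- The signed incidence vector of the clause: the matrix a aᵀ is psd, and its quadratic form is
  -- the square of the sum of the literals.
  let a (i : Fin n) : ℝ := ∑ t, if C.var t = i then signR (C.sgn t) else 0
  have h := hρ (Matrix.vecMulVec a a) (by simpa using Matrix.posSemidef_vecMulVec_self_star a)
  have h1 : ‖C.vecSum u‖ ^ 2 = ∑ i, ∑ j, Matrix.vecMulVec a a i j * inner ℝ (u i) (u j) := by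
    rw [Clause.vecSum, ← C.sum_sgn_smul u, ← real_inner_self_eq_norm_sq, sum_inner]
    refine Finset.sum_congr rfl fun i _ => ?_
    rw [inner_sum]
    refine Finset.sum_congr rfl fun j _ => ?_
    rw [real_inner_smul_left, real_inner_smul_right, Matrix.vecMulVec_apply]
    ring
  have h2 : ∀ z : Assignment n, (∑ t, signR (C.literal z t)) ^ 2 =
      ∑ i, ∑ j, Matrix.vecMulVec a a i j * (signR (z i) * signR (z j)) := by
    intro z
    have := C.sum_sgn_smul fun i => signR (z i)
    simp only [smul_eq_mul] at this
    simp_rw [Clause.literal, signR_mul]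
    rw [← this, sq, Finset.sum_mul_sum]
    refine Finset.sum_congr rfl fun i _ => Finset.sum_congr rfl fun j _ => ?_
    rw [Matrix.vecMulVec_apply]
    ring
  rw [h1]
  simp_rw [h2]
  exact h

variable {ι : Type*} [Fintype ι]

lemma relax_term_nonneg {S : ι → Clause n k} {w : ι → ℝ} (hw : ∀ j, 0 ≤ w j)
    (u : Fin n → EuclideanSpace ℝ (Fin d)) : 0 ≤ ∑ j, w j * ‖(S j).vecSum u‖ ^ 2 :=
  Finset.sum_nonneg fun j _ => mul_nonneg (hw j) (sq_nonneg _)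

lemma aeValue_nonneg {S : ι → Clause n k} {w : ι → ℝ} (hw : ∀ j, 0 ≤ w j) (x : Assignment n) :
    0 ≤ aeValue S w x :=
  Finset.sum_nonneg fun j _ => by split_ifs <;> simp [hw j]

/-- On a satisfied clause the vectors ±e align, so the sum is ±k e. The norm hypothesis is
conditional on a variable existing, which the clause itself supplies. -/
lemma norm_vecSum_of_sat {C : Clause n k} {x : Assignment n} (h : C.Sat x) (hk : 0 < k)
    {e : EuclideanSpace ℝ (Fin d)} (he : ∀ _ : Fin n, ‖e‖ = 1) :
    ‖C.vecSum fun i => signR (x i) • e‖ ^ 2 = (k : ℝ) ^ 2 := by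
  have h1 : (C.vecSum fun i => signR (x i) • e) = (∑ t, signR (C.literal x t)) • e := by
    simp_rw [Clause.vecSum, Clause.literal, signR_mul, Finset.sum_smul, mul_smul]
  rw [h1, norm_smul, he (C.var ⟨0, hk⟩), mul_one, Real.norm_eq_abs, sq_abs]
  rcases h with h | h <;> simp [h, signR]

/-- The relaxation bounds the optimal value of Max k-AllEqual. -/
lemma aeOpt_le_of_isOptimalRelax (hk : 2 ≤ k) {S : ι → Clause n k} {W : Set (ι → ℝ)}
    (hW : ∀ w ∈ W, ∀ j, 0 ≤ w j) {u : Fin n → EuclideanSpace ℝ (Fin d)}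
    (hu : IsOptimalRelax S W u) {w : ι → ℝ} (hw : w ∈ W) :
    aeOpt S W ≤ 1 / (k : ℝ) ^ 2 * ∑ j, w j * ‖(S j).vecSum u‖ ^ 2 := by
  have hk' : (0 : ℝ) < k := by positivity
  have bdd : ∀ v : Fin n → EuclideanSpace ℝ (Fin d),
      BddBelow (Set.range fun w : W => ∑ j, w.1 j * ‖(S j).vecSum v‖ ^ 2) := fun v =>
    ⟨0, by rintro _ ⟨w, rfl⟩; exact relax_term_nonneg (hW w.1 w.2) v⟩
  have : Nonempty W := ⟨⟨w, hw⟩⟩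
  have h1 : relaxObjective S W u ≤ 1 / (k : ℝ) ^ 2 * ∑ j, w j * ‖(S j).vecSum u‖ ^ 2 :=
    mul_le_mul_of_nonneg_left (ciInf_le (bdd u) ⟨w, hw⟩) (by positivity)
  refine le_trans (ciSup_le fun x => ?_) h1
  -- For d = 0 there is no unit vector. If some variable exists, the feasible `u` provides one; if n
  -- = 0, none is needed.
  obtain ⟨e, he⟩ : ∃ e : EuclideanSpace ℝ (Fin d), ∀ _ : Fin n, ‖e‖ = 1 := by
    rcases isEmpty_or_nonempty (Fin n) with h | ⟨⟨i⟩⟩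
    · exact ⟨0, fun i => isEmptyElim i⟩
    · exact ⟨u i, fun _ => hu.1 i⟩
  refine le_trans ?_ (hu.2 (fun i => signR (x i) • e) fun i => by
    rw [norm_smul, he i, Real.norm_eq_abs, abs_signR, one_mul])
  rw [relaxObjective, Real.mul_iInf_of_nonneg (by positivity)]
  refine ciInf_mono ⟨0, by rintro _ ⟨w, rfl⟩; exact aeValue_nonneg (hW w.1 w.2) x⟩ fun w => ?_
  rw [aeValue, Finset.mul_sum]
  refine Finset.sum_le_sum fun j _ => ?_
  split_ifs with h
  · rw [norm_vecSum_of_sat h (by omega) he]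
    field_simp
    rfl
  · have := hW w.1 w.2 j
    positivity

theorem expect_aeOutput_ge (hk : 2 ≤ k) {S : ι → Clause n k} {W : Set (ι → ℝ)}
    (hW : ∀ w ∈ W, ∀ j, 0 ≤ w j) {u : Fin n → EuclideanSpace ℝ (Fin d)}
    (hu : IsOptimalRelax S W u) {ρ : PMF (Assignment n)} (hρ : IsRounding u ρ) {w : ι → ℝ}
    (hw : w ∈ W) :
    0.88 * (k : ℝ) / 2 ^ k * aeOpt S W ≤ expect (aeOutput hk ρ) (aeValue S w) := by
  classical
  have hk' : (0 : ℝ) < k := by positivity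
  have hval : expect (aeOutput hk ρ) (aeValue S w) = ∑ j, w j * expect ρ fun z =>
      expect (assignLaw hk z) fun x => if (S j).Sat x then 1 else 0 := by
    have h : ∀ x, aeValue S w x = ∑ j, w j * if (S j).Sat x then 1 else 0 := fun x =>
      Finset.sum_congr rfl fun j _ => by simp
    simp_rw [aeOutput, expect_bind, funext h, expect_sum, expect_const_mul]
  rw [hval]
  calc 0.88 * (k : ℝ) / 2 ^ k * aeOpt S W
      ≤ 0.88 * (k : ℝ) / 2 ^ k * (1 / (k : ℝ) ^ 2 * ∑ j, w j * ‖(S j).vecSum u‖ ^ 2) := by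
        gcongr
        exact aeOpt_le_of_isOptimalRelax hk hW hu hw
    _ = ∑ j, w j * (0.44 * Real.pi / (k * 2 ^ k) * (2 / Real.pi * ‖(S j).vecSum u‖ ^ 2)) := by
        have := Real.pi_pos
        simp_rw [Finset.mul_sum]
        refine Finset.sum_congr rfl fun j _ => ?_
        field_simp
        ring
    _ ≤ _ := by
        refine Finset.sum_le_sum fun j _ => mul_le_mul_of_nonneg_left ?_ (hW w hw j)
        refine (mul_le_mul_of_nonneg_left (hρ.expect_sq_ge (S j)) (by positivity)).trans ?_
        rw [← expect_const_mul]
        exact expect_mono ρ fun z => expect_assignLaw_sat_ge hk (S j) z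

end AllEqual

/-! ### The reduction from k-CSP -/

section CSP

variable {n k d : ℕ} {ι : Type*} [Fintype ι]

open Classical in
/-- The clauses of the reduction count the constraints satisfied by an assignment and by its
negation. -/
lemma aeValue_reduceClauses (hk : 0 < k) (S : ι → Constraint n k) (w : ι → ℝ)
    (x : Assignment n) :
    aeValue (reduceClauses S) (fun p => w p.1) x = cspValue S w x + cspValue S w (-x) := by
  rw [aeValue, cspValue, cspValue, ← Finset.sum_add_distrib, Fintype.sum_sigma]
  refine Finset.sum_congr rfl fun j _ => ?_
  let y : Fin k → ℤˣ := fun t => x ((S j).var t)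
  have h1 : ∀ a : {a : Fin k → ℤˣ // a ∈ (S j).allowed},
      (if (reduceClauses S ⟨j, a⟩).Sat x then w j else 0) =
        (fun a => (if a = y then w j else 0) + if a = -y then w j else 0) a.1 := by
    rintro ⟨a, ha⟩
    have e1 : (∀ t, (reduceClauses S ⟨j, a, ha⟩).literal x t = 1) ↔ a = y := by
      rw [funext_iff]
      refine forall_congr' fun t => ?_
      change a t * y t = 1 ↔ _
      rw [mul_eq_one_iff_eq_inv, Int.units_inv_eq_self]
    have e2 : (∀ t, (reduceClauses S ⟨j, a, ha⟩).literal x t = -1) ↔ a = -y := by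
      rw [funext_iff]
      refine forall_congr' fun t => ?_
      change a t * y t = -1 ↔ _
      rw [← eq_mul_inv_iff_mul_eq, Int.units_inv_eq_self, neg_one_mul, Pi.neg_apply]
    -- As k > 0, `y` and `-y` differ, so no clause is counted twice.
    have hne : a = y → a ≠ -y := by
      rintro h h'
      have := congr_fun (h.symm.trans h') ⟨0, hk⟩
      rcases Int.units_eq_one_or (y ⟨0, hk⟩) with h0 | h0 <;>
        simp only [Pi.neg_apply, h0] at this <;> exact absurd this (by decide)
    rw [Clause.Sat, e1, e2]
    by_cases hy : a = y
    · rw [if_pos (Or.inl hy)]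
      simp only [if_pos hy, if_neg (hne hy), add_zero]
    · simp only [hy, false_or, if_false, zero_add]
  simp_rw [h1]
  rw [Finset.sum_coe_sort (S j).allowed
    fun a => (if a = y then w j else 0) + if a = -y then w j else 0, Finset.sum_add_distrib,
    Finset.sum_ite_eq', Finset.sum_ite_eq']
  congr 1 <;> exact if_congr Iff.rfl rfl rfl

lemma cspValue_nonneg {S : ι → Constraint n k} {w : ι → ℝ} (hw : ∀ j, 0 ≤ w j)
    (x : Assignment n) : 0 ≤ cspValue S w x :=
  Finset.sum_nonneg fun j _ => by split_ifs <;> simp [hw j]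

/-- For each `x`, the reduced value is the CSP value at `x` plus the nonnegative value at `-x`. -/
lemma cspOpt_le_aeOpt_reduce (hk : 0 < k) {S : ι → Constraint n k} {W : Set (ι → ℝ)}
    (hW : ∀ w ∈ W, ∀ j, 0 ≤ w j) :
    cspOpt S W ≤ aeOpt (reduceClauses S) (reduceWeights S W) := by
  refine ciSup_mono (Set.finite_range _).bddAbove fun x => ?_
  -- For empty `W` both infima take the default value 0.
  rcases W.eq_empty_or_nonempty with rfl | ⟨w₀, hw₀⟩
  · simp [reduceWeights]
  have : Nonempty (reduceWeights S W) := ⟨⟨_, w₀, hw₀, rfl⟩⟩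
  refine le_ciInf ?_
  rintro ⟨_, w, hw, rfl⟩
  refine (ciInf_le ⟨0, ?_⟩ (⟨w, hw⟩ : W)).trans ?_
  · rintro _ ⟨w, rfl⟩
    exact cspValue_nonneg (hW w.1 w.2) x
  · rw [aeValue_reduceClauses hk]
    linarith [cspValue_nonneg (S := S) (hW w hw) (-x)]

lemma expect_cspOutput (hk : 2 ≤ k) (ρ : PMF (Assignment n)) (S : ι → Constraint n k)
    (w : ι → ℝ) :
    expect (cspOutput hk ρ) (cspValue S w) =
      1 / 2 * expect (aeOutput hk ρ) (aeValue (reduceClauses S) fun p => w p.1) := by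
  rw [cspOutput, expect_bind, ← expect_const_mul]
  congr 1
  funext x
  rw [expect_map, expect_uniform_sign, aeValue_reduceClauses (by omega)]
  have h1 : (fun i => 1 * x i) = x := by simp
  have h2 : (fun i => -1 * x i) = -x := by ext i; simp
  rw [h1, h2]
  ring

theorem expect_cspOutput_ge (hk : 2 ≤ k) {S : ι → Constraint n k} {W : Set (ι → ℝ)}
    (hW : ∀ w ∈ W, ∀ j, 0 ≤ w j) {u : Fin n → EuclideanSpace ℝ (Fin d)}
    (hu : IsOptimalRelax (reduceClauses S) (reduceWeights S W) u) {ρ : PMF (Assignment n)}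
    (hρ : IsRounding u ρ) {w : ι → ℝ} (hw : w ∈ W) :
    0.44 * (k : ℝ) / 2 ^ k * cspOpt S W ≤ expect (cspOutput hk ρ) (cspValue S w) := by
  have hW' : ∀ w ∈ reduceWeights S W, ∀ p, 0 ≤ w p := by
    rintro _ ⟨w, hw, rfl⟩ p
    exact hW w hw p.1
  have h := expect_aeOutput_ge hk hW' hu hρ ⟨w, hw, rfl⟩
  rw [expect_cspOutput]
  calc 0.44 * (k : ℝ) / 2 ^ k * cspOpt S W
      ≤ 0.44 * (k : ℝ) / 2 ^ k * aeOpt (reduceClauses S) (reduceWeights S W) := by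
        gcongr
        exact cspOpt_le_aeOpt_reduce (by omega) hW
    _ = 1 / 2 * (0.88 * (k : ℝ) / 2 ^ k * aeOpt (reduceClauses S) (reduceWeights S W)) := by
        ring
    _ ≤ _ := by gcongr

end CSP

end RobustCSP

theorem mainTheorem5 (k : ℕ) (hk : 2 ≤ k) (n d : ℕ) :
    -- random hyperplane rounding is an admissible rounding
    (∀ u : Fin n → EuclideanSpace ℝ (Fin d), (∀ i, ‖u i‖ = 1) →
      RobustCSP.IsRounding u (RobustCSP.hyperplaneLaw u)) ∧
    -- robust Max k-AllEqual
    (∀ (ι : Type*) [Fintype ι] (S : ι → RobustCSP.Clause n k) (W : Set (ι → ℝ)),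
      (∀ w ∈ W, ∀ j, 0 ≤ w j) →
      ∀ u : Fin n → EuclideanSpace ℝ (Fin d), RobustCSP.IsOptimalRelax S W u →
      ∀ ρ : PMF (RobustCSP.Assignment n), RobustCSP.IsRounding u ρ →
      ∀ w ∈ W,
        0.88 * (k : ℝ) / 2 ^ k * RobustCSP.aeOpt S W ≤
          RobustCSP.expect (RobustCSP.aeOutput hk ρ) (RobustCSP.aeValue S w)) ∧
    -- robust Max k-CSP
    (∀ (ι : Type*) [Fintype ι] (S : ι → RobustCSP.Constraint n k) (W : Set (ι → ℝ)),
      (∀ w ∈ W, ∀ j, 0 ≤ w j) →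
      ∀ u : Fin n → EuclideanSpace ℝ (Fin d),
      RobustCSP.IsOptimalRelax (RobustCSP.reduceClauses S) (RobustCSP.reduceWeights S W) u →
      ∀ ρ : PMF (RobustCSP.Assignment n), RobustCSP.IsRounding u ρ →
      ∀ w ∈ W,
        0.44 * (k : ℝ) / 2 ^ k * RobustCSP.cspOpt S W ≤
          RobustCSP.expect (RobustCSP.cspOutput hk ρ) (RobustCSP.cspValue S w)) := by
  exact ⟨fun u hu => RobustCSP.isRounding_hyperplaneLaw u hu,
    fun _ _ _ _ hW _ hu _ hρ _ hw => RobustCSP.expect_aeOutput_ge hk hW hu hρ hw,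
    fun _ _ _ _ hW _ hu _ hρ _ hw => RobustCSP.expect_cspOutput_ge hk hW hu hρ hw⟩
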